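/- **Setting.** Let $\operatorname{SE}_3$ be the group of matrices $\begin{pmatrix}R&w\\0&1\end{pmatrix}$ with $R\in\operatorname{SO}_3$, $w\in\mathbb R^3$, and $\mathfrak{se}_3$ its Lie algebra with the commutator bracket. For $x\in\mathbb R^6$ put $$\operatorname{mat}_{\mathfrak{se}}(x)=\begin{pmatrix}\operatorname{mat}_{\mathfrak{so}}(x_{1:3})&x_{4:6}\\0&0\end{pmatrix},\qquad \operatorname{mat}_{\mathfrak{so}}(w)=\tfrac1{\sqrt2}\begin{pmatrix}0&-w_3&w_2\\w_3&0&-w_1\\-w_2&w_1&0\end{pmatrix},$$ $\operatorname{vec}_{\mathfrak{se}}=\operatorname{mat}_{\mathfrak{se}}^{-1}$, and let $\operatorname{Pr}:\mathbb R^{4\times4}\to\mathfrak{se}_3$, $\operatorname{Pr}(A)=\frac12 D\,(A\operatorname{diag}(1,1,1,2)-A^\top D)$ with $D=\operatorname{diag}(1,1,1,0)$. Let $\mathcal G=\operatorname{SE}_3\times\mathbb R^6$ (product group, $\mathbb R^6$ additive), $\mathfrak g=\mathfrak{se}_3\times\mathbb R^6$, $\operatorname{vec}_{\mathfrak g}(\eta_1,\eta_2)=(\operatorname{vec}_{\mathfrak{se}}\eta_1,\eta_2)\in\mathbb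 R^{12}$, $\operatorname{mat}_{\mathfrak g}=\operatorname{vec}_{\mathfrak g}^{-1}$, $\operatorname{Exp}(\eta_1,\eta_2)=(e^{\eta_1},\eta_2)$, and $G\eta=(E\eta_1,\eta_2)$ for $G=(E,v)\in\mathcal G$, $\eta\in\mathfrak g$. Write $\operatorname{ad}_{\mathfrak g}(x)\in\mathbb R^{12\times12}$ for the matrix of $\operatorname{ad}(\operatorname{mat}_{\mathfrak g}x)$ in the coordinates $\operatorname{vec}_{\mathfrak g}$, and, for $\varphi:\mathcal G\to\mathbb R^p$, write $\mathbf d\varphi(G)\in\mathbb R^{p\times12}$ for the matrix of the derivative of $x\mapsto\varphi(G\operatorname{Exp}(\operatorname{mat}_{\mathfrak g}x))$ at $x=0$. **The filter.** Let $f:\mathcal G\to\mathfrak g$, $h:\mathcal G\to\mathbb R^p$. For the state equation $\dot G=G(f(G)+\delta)$, with white noise $\delta$ of covariance $S\in\mathbb R^{12\times12}$ (in the coordinates $\operatorname{vec}_{\mathfrak g}$), and the observation $z=h(G(t_l))+\varepsilon$, with noise $\varepsilon$ of covariance $Q_l$, one step of the continuous-discrete extended Kalman filter (CD-LG-EKF)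 on $\mathcal G$, from $(G(t_{l-1}),P(t_{l-1}))$ to $(G(t_l),P(t_l))$, is as follows. *Propagation on $[t_{l-1},t_l]$:* $\dot G=Gf(G)$ and $$\dot P=JP+PJ^\top+S+\tfrac14\mathbb E\bigl(\operatorname{ad}_{\mathfrak g}(\epsilon)S\operatorname{ad}_{\mathfrak g}(\epsilon)^\top\bigr)+\tfrac1{12}\mathbb E\bigl(\operatorname{ad}_{\mathfrak g}(\epsilon)^2\bigr)S+\tfrac1{12}S\,\mathbb E\bigl(\operatorname{ad}_{\mathfrak g}(\epsilon)^2\bigr)^\top,$$ where $\epsilon\sim N(0,P(t))$, the matrix $P(t)$ being positive semidefinite, and $$J(t)=F(t)-\operatorname{ad}_{\mathfrak g}(\operatorname{vec}_{\mathfrak g}f(G(t)))+\tfrac1{12}C(S),\qquad F(t)=\mathbf d(\operatorname{vec}_{\mathfrak g}\circ f)(G(t)),\qquad C(S)=\sum_{i,j}S_{ij}\operatorname{ad}_{\mathfrak g}(e_i)\operatorname{ad}_{\mathfrak g}(e_j).$$ The values at $t_l$ are $G^-,P^-$. *Update:* with $H=\mathbf dh(G^-)$ set $K=P^-H^\top(HP^-H^\top+Q_l)^{-1}$,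 $m=K(z-h(G^-))$, $G(t_l)=G^-\operatorname{Exp}(\operatorname{mat}_{\mathfrak g}m)$ and $P(t_l)=\Phi(m)(\mathbb 1_{12}-KH)P^-\Phi(m)^\top$, where $\Phi(x)=\sum_{k\ge0}\frac{(-1)^k}{(k+1)!}\operatorname{ad}_{\mathfrak g}(x)^k$. **Proposition.** Consider the constant-acceleration model $f(E,v)=(\operatorname{mat}_{\mathfrak{se}}(v),0)$ with $n$ linear observations $y_k(t_l)=E(t_l)a_k+\varepsilon_k(t_l)\in\mathbb R^4$, $a_k\in\mathbb R^4$, which enter the filter through their sum, i.e. $h=\sum_k h_k$ with $h_k(E,v)=Ea_k$, $z=\sum_ky_k(t_l)$, and $Q_l\in\mathbb R^{4\times4}$ positive definite. Let $S$ be positive semidefinite. Then the CD-LG-EKF step is given by the following algorithm. - Integrate on $[t_{l-1},t_l]$ the equations $\dot E=E\operatorname{mat}_{\mathfrak{se}}(v)$, $\dot v=0$, and the equation for $\dot P$ above (again with $P(t)$ positive semidefinite); let $G^-=(E^-,v^-)$ and $P^-$ be the values at $t_l$. - $K_l=P^-H_l^\top(H_lP^-H_l^\top+Q_l)^{-1}$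 and $m=K_l\sum_{k=1}^n\bigl(y_k(t_l)-E^-a_k\bigr)$. - $E(t_l)=E^-\exp(\operatorname{mat}_{\mathfrak{se}}(m_{1:6}))$, $v(t_l)=v^-+m_{7:12}$ and $P(t_l)=\Phi(m)(\mathbb 1_{12}-K_lH_l)P^-\Phi(m)^\top$. That is, the same data (propagated state and covariance, gain, correction, updated state and covariance) satisfy the equations of the filter step if and only if they satisfy those of the algorithm. In the algorithm, the matrices are explicit: 1. $H_l=\sum_{k=1}^nH_l^k$, where $H_l^k\in\mathbb R^{4\times12}$ is the matrix whose $i$-th row is $\bigl(\operatorname{vec}_{\mathfrak{se}}(\operatorname{Pr}((E^-)^\top e_ia_k^\top))^\top,\ \mathbf 0_{1\times6}\bigr)$, $i=1,\dots,4$. Moreover $\mathbf dh_k(G^-)=H_l^k$. 2. $J(t)=F-\operatorname{ad}_{\mathfrak g}\bigl((v(t),0)\bigr)+\tfrac1{12}C(S)$ with $F=\begin{pmatrix}\mathbf 0&\mathbb 1_6\\\mathbf 0&\mathbf 0\end{pmatrix}$ and, for $x\in\mathbb R^{12}$, $$\operatorname{ad}_{\mathfrak g}(x)=\begin{pmatrix}\operatorname{ad}_{\mathfrak{se}}(x_{1:6})&\mathbf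 0\\\mathbf 0&\mathbf 0\end{pmatrix},\qquad\operatorname{ad}_{\mathfrak{se}}(u)=\begin{pmatrix}\operatorname{mat}_{\mathfrak{so}}(u_{1:3})&\mathbf 0\\\operatorname{mat}_{\mathfrak{so}}(u_{4:6})&\operatorname{mat}_{\mathfrak{so}}(u_{1:3})\end{pmatrix}.$$ If $S$ is diagonal, then $$C(S)=\begin{pmatrix}\begin{pmatrix}\Xi&\mathbf 0\\\mathbf 0&\Xi\end{pmatrix}&\mathbf 0\\\mathbf 0&\mathbf 0\end{pmatrix},\qquad\Xi=-\tfrac12\operatorname{diag}(S_{22}+S_{33},\,S_{11}+S_{33},\,S_{11}+S_{22}).$$ 3. $\Phi(x)=\begin{pmatrix}\Phi_{\operatorname{SE}_3}(x_{1:6})&\mathbf 0\\\mathbf 0&\mathbb 1_6\end{pmatrix}$ with $\Phi_{\operatorname{SE}_3}(u)=\sum_{k\ge0}\frac{(-1)^k}{(k+1)!}\operatorname{ad}_{\mathfrak{se}}(u)^k$. -/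

import Mathlib

attribute [local instance] LieRing.ofAssociativeRing

namespace LieEKF

open Matrix MeasureTheory ProbabilityTheory

/-! ## The group `SE₃` and its Lie algebra -/

/-- Coordinates of `ℝ⁶ = ℝ³ × ℝ³`: first the three rotational, then the three translational ones,
so that `x (.inl 0), x (.inl 1), x (.inl 2), x (.inr 0), x (.inr 1), x (.inr 2)` are
`x₁, …, x₆`. -/
abbrev I6 : Type := Fin 3 ⊕ Fin 3

/-- Coordinates of `ℝ¹² = ℝ⁶ × ℝ⁶`: first those of `se₃`, then those of the velocity. -/
abbrev I12 : Type := I6 ⊕ I6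

/-- The upper left `3 × 3` block of a `4 × 4` matrix. -/
def rotBlock (A : Matrix (Fin 4) (Fin 4) ℝ) : Matrix (Fin 3) (Fin 3) ℝ :=
  A.submatrix Fin.castSucc Fin.castSucc

lemma rotBlock_mul (A B : Matrix (Fin 4) (Fin 4) ℝ) (hB : B 3 = Pi.single 3 1) :
    rotBlock (A * B) = rotBlock A * rotBlock B := by
  ext i j
  have h0 : B 3 j.castSucc = 0 := by
    rw [hB, Pi.single_apply, if_neg]
    exact fun h => absurd h (Fin.castSucc_lt_last j).ne
  simp only [rotBlock, Matrix.submatrix_apply, Matrix.mul_apply]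
  rw [Fin.sum_univ_castSucc]
  have : (Fin.last 3 : Fin 4) = 3 := rfl
  rw [this, h0, mul_zero, add_zero]

lemma row_mul (A B : Matrix (Fin 4) (Fin 4) ℝ) (hA : A 3 = Pi.single 3 1) :
    (A * B) 3 = B 3 := by
  ext j
  simp [Matrix.mul_apply, hA, Pi.single_apply]

lemma rotBlock_one : rotBlock 1 = 1 := by
  ext i j
  simp [rotBlock, Matrix.one_apply]

lemma row_one : (1 : Matrix (Fin 4) (Fin 4) ℝ) 3 = Pi.single 3 1 := by
  ext j
  rw [Matrix.one_apply, Pi.single_apply]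
  simp only [eq_comm]

/-- `SE₃`: the invertible matrices `(R w; 0 1)` with `R ∈ SO₃`, `w ∈ ℝ³`. -/
def SE3 : Subgroup (GL (Fin 4) ℝ) where
  carrier := {E | rotBlock (E : Matrix (Fin 4) (Fin 4) ℝ) ∈ specialOrthogonalGroup (Fin 3) ℝ ∧
    (E : Matrix (Fin 4) (Fin 4) ℝ) 3 = Pi.single 3 1}
  mul_mem' := by
    rintro A B ⟨hA, hA'⟩ ⟨hB, hB'⟩
    refine ⟨?_, ?_⟩
    · rw [Units.val_mul, rotBlock_mul _ _ hB']
      exact mul_mem hA hB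
    · rw [Units.val_mul, row_mul _ _ hA', hB']
  one_mem' := by
    refine ⟨?_, ?_⟩
    · rw [Units.val_one, rotBlock_one]
      exact one_mem _
    · rw [Units.val_one, row_one]
  inv_mem' := by
    rintro A ⟨hA, hA'⟩
    have h1 : ((A⁻¹ : GL (Fin 4) ℝ) : Matrix (Fin 4) (Fin 4) ℝ) 3 = Pi.single 3 1 := by
      rw [← row_mul (A : Matrix (Fin 4) (Fin 4) ℝ)
        ((A⁻¹ : GL (Fin 4) ℝ) : Matrix (Fin 4) (Fin 4) ℝ) hA', ← Units.val_mul, mul_inv_cancel,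
        Units.val_one, row_one]
    refine ⟨?_, h1⟩
    have h2 := rotBlock_mul (A : Matrix (Fin 4) (Fin 4) ℝ) _ h1
    rw [← Units.val_mul, mul_inv_cancel, Units.val_one, rotBlock_one] at h2
    have h3 := (mem_specialOrthogonalGroup_iff.1 hA)
    have h4 := (mem_orthogonalGroup_iff' (Fin 3) ℝ).1 h3.1
    have h5 : rotBlock ((A⁻¹ : GL (Fin 4) ℝ) : Matrix (Fin 4) (Fin 4) ℝ) =
        star (rotBlock (A : Matrix (Fin 4) (Fin 4) ℝ)) := by
      calc _ = star (rotBlock (A : Matrix (Fin 4) (Fin 4) ℝ)) *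
              rotBlock (A : Matrix (Fin 4) (Fin 4) ℝ) *
              rotBlock ((A⁻¹ : GL (Fin 4) ℝ) : Matrix (Fin 4) (Fin 4) ℝ) := by
                rw [star_eq_conjTranspose, conjTranspose_eq_transpose_of_trivial, h4, one_mul]
        _ = _ := by rw [mul_assoc, ← h2, mul_one]
    rw [h5]
    exact (⟨_, hA⟩ : specialOrthogonalGroup (Fin 3) ℝ)⁻¹.2

/-- `se₃`: the matrices `(Ω w; 0 0)` with `Ω` skew-symmetric; the bracket is the commutator. -/
def se3 : LieSubalgebra ℝ (Matrix (Fin 4) (Fin 4) ℝ) where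
  carrier := {A | (rotBlock A)ᵀ = -rotBlock A ∧ A 3 = 0}
  add_mem' := by
    rintro A B ⟨hA, hA'⟩ ⟨hB, hB'⟩
    refine ⟨?_, by funext j; simp [hA', hB']⟩
    have : rotBlock (A + B) = rotBlock A + rotBlock B := rfl
    rw [this, transpose_add, hA, hB, neg_add]
  zero_mem' := ⟨by ext i j; simp [rotBlock], rfl⟩
  smul_mem' := by
    rintro c A ⟨hA, hA'⟩
    refine ⟨?_, by funext j; simp [hA']⟩
    have : rotBlock (c • A) = c • rotBlock A := rfl
    rw [this, transpose_smul, hA, smul_neg]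
  lie_mem' := by
    rintro A B ⟨hA, hA'⟩ ⟨hB, hB'⟩
    have key : ∀ A B : Matrix (Fin 4) (Fin 4) ℝ, B 3 = 0 →
        rotBlock (A * B) = rotBlock A * rotBlock B := by
      intro A B hB
      ext i j
      have h0 : B 3 j.castSucc = 0 := by rw [hB]; rfl
      simp only [rotBlock, Matrix.submatrix_apply, Matrix.mul_apply]
      rw [Fin.sum_univ_castSucc]
      have : (Fin.last 3 : Fin 4) = 3 := rfl
      rw [this, h0, mul_zero, add_zero]
    refine ⟨?_, ?_⟩
    · have h : rotBlock (A * B - B * A) =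
          rotBlock A * rotBlock B - rotBlock B * rotBlock A := by
        rw [← key A B hB', ← key B A hA']; rfl
      change (rotBlock (A * B - B * A))ᵀ = -rotBlock (A * B - B * A)
      rw [h, transpose_sub, transpose_mul, transpose_mul, hA, hB]
      simp
    · change (A * B - B * A) 3 = 0
      funext j
      simp [Matrix.mul_apply, hA', hB']

/-- The matrix `mat_so(w)`, with the normalising factor `1/√2`. -/
noncomputable def matSO (w : Fin 3 → ℝ) : Matrix (Fin 3) (Fin 3) ℝ :=
  !![0, -(w 2 / √2), w 1 / √2;
     w 2 / √2, 0, -(w 0 / √2);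
     -(w 1 / √2), w 0 / √2, 0]

/-- The linear isomorphism `vec_se : se₃ → ℝ⁶`; its inverse is
`mat_se(x) = (mat_so(x₁, x₂, x₃), (x₄, x₅, x₆)ᵀ; 0, 0)`. -/
noncomputable def vecSE : se3 ≃ₗ[ℝ] (I6 → ℝ) where
  toFun A := Sum.elim
    ![√2 * (A : Matrix (Fin 4) (Fin 4) ℝ) 2 1, √2 * (A : Matrix (Fin 4) (Fin 4) ℝ) 0 2,
      √2 * (A : Matrix (Fin 4) (Fin 4) ℝ) 1 0]
    ![(A : Matrix (Fin 4) (Fin 4) ℝ) 0 3, (A : Matrix (Fin 4) (Fin 4) ℝ) 1 3,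
      (A : Matrix (Fin 4) (Fin 4) ℝ) 2 3]
  map_add' A B := by
    ext (i | i) <;> fin_cases i <;> simp [mul_add]
  map_smul' c A := by
    ext (i | i) <;> fin_cases i <;> simp [mul_left_comm]
  invFun x := ⟨!![0, -(x (.inl 2) / √2), x (.inl 1) / √2, x (.inr 0);
      x (.inl 2) / √2, 0, -(x (.inl 0) / √2), x (.inr 1);
      -(x (.inl 1) / √2), x (.inl 0) / √2, 0, x (.inr 2);
      0, 0, 0, 0], by
    refine ⟨?_, ?_⟩
    · ext i j
      fin_cases i <;> fin_cases j <;> simp [rotBlock]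
    · ext j
      fin_cases j <;> simp⟩
  left_inv := by
    rintro ⟨A, hA, hA'⟩
    have h2 : √2 ≠ 0 := by positivity
    have h : ∀ i j : Fin 3, A j.castSucc i.castSucc = -A i.castSucc j.castSucc :=
      fun i j => congrFun (congrFun hA i) j
    have h00 := h 0 0
    have h01 := h 0 1
    have h02 := h 0 2
    have h11 := h 1 1
    have h12 := h 1 2
    have h22 := h 2 2
    have h3 : ∀ j, A 3 j = 0 := fun j => congrFun hA' j
    simp at h00 h01 h02 h11 h12 h22
    ext i j
    fin_cases i <;> fin_cases j <;>
      simp [h2, h3] <;> linarith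
  right_inv x := by
    have h2 : √2 ≠ 0 := by positivity
    ext (i | i) <;> fin_cases i <;> simp <;> field_simp

/-- `mat_se = vec_se⁻¹`. -/
noncomputable abbrev matSE (x : I6 → ℝ) : se3 := vecSE.symm x

/-- The projection `Pr : ℝ^{4×4} → se₃`. -/
noncomputable def prSE (A : Matrix (Fin 4) (Fin 4) ℝ) : se3 :=
  ⟨(1 / 2 : ℝ) • (diagonal ![1, 1, 1, 0] *
      (A * diagonal ![1, 1, 1, 2] - Aᵀ * diagonal ![1, 1, 1, 0])), by
    refine ⟨?_, ?_⟩
    · ext i j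
      fin_cases i <;> fin_cases j <;> simp [rotBlock, Matrix.diagonal_mul, Matrix.mul_diagonal] <;>
        ring
    · ext j
      simp [Matrix.diagonal_mul]⟩

/-! ## The exponential map of `SE₃` -/

lemma det_rotBlock (A : Matrix (Fin 4) (Fin 4) ℝ) (hA : A 3 = Pi.single 3 1) :
    (rotBlock A).det = A.det := by
  have h3 : ∀ j, A 3 j = (Pi.single 3 1 : Fin 4 → ℝ) j := fun j => congrFun hA j
  rw [Matrix.det_succ_row A 3, Fin.sum_univ_four]
  simp only [h3]
  simp [rotBlock]
  rw [Even.neg_one_pow (by decide), one_mul]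
  congr 1
  ext i j
  fin_cases i <;> fin_cases j <;> rfl

section
attribute [local instance] Matrix.linftyOpNormedRing Matrix.linftyOpNormedAlgebra

lemma exp_semiconj {x a b : Matrix (Fin 4) (Fin 4) ℝ} (h : x * a = b * x) :
    x * NormedSpace.exp a = NormedSpace.exp b * x :=
  SemiconjBy.exp_right h
end

lemma exp_row (A : Matrix (Fin 4) (Fin 4) ℝ) (hA : A 3 = 0) :
    (NormedSpace.exp A) 3 = Pi.single 3 1 := by
  have h : Matrix.single (3 : Fin 4) (3 : Fin 4) (1 : ℝ) * A =
      0 * Matrix.single (3 : Fin 4) (3 : Fin 4) (1 : ℝ) := by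
    ext i j
    by_cases hi : 3 = i
    · subst hi
      simp [hA]
    · rw [Matrix.single_mul_apply_of_ne (h := Ne.symm hi)]
      simp
  have h' := exp_semiconj h
  rw [NormedSpace.exp_zero, one_mul] at h'
  ext j
  have := congrFun (congrFun h' 3) j
  rw [Matrix.single_mul_apply_same, one_mul] at this
  rw [this, Matrix.single_apply, Pi.single_apply]
  simp [eq_comm]

lemma exp_det_isUnit (A : Matrix (Fin 4) (Fin 4) ℝ) : IsUnit (NormedSpace.exp A).det := by
  have h := Matrix.isUnit_exp A
  rwa [Matrix.isUnit_iff_isUnit_det] at h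

lemma exp_det_pos (A : Matrix (Fin 4) (Fin 4) ℝ) : 0 < (NormedSpace.exp A).det := by
  have h : NormedSpace.exp A =
      NormedSpace.exp ((1 / 2 : ℝ) • A) * NormedSpace.exp ((1 / 2 : ℝ) • A) := by
    rw [← Matrix.exp_add_of_commute _ _ (Commute.refl _), ← add_smul]
    norm_num
  have hu : (NormedSpace.exp ((1 / 2 : ℝ) • A)).det ≠ 0 :=
    (exp_det_isUnit ((1 / 2 : ℝ) • A)).ne_zero
  rw [h, det_mul]
  exact mul_self_pos.2 hu

lemma exp_mem (A : se3) :
    (Matrix.isUnit_exp (A : Matrix (Fin 4) (Fin 4) ℝ)).unit ∈ SE3 := by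
  obtain ⟨A, hA, hA'⟩ := A
  have hrow := exp_row A hA'
  have h3 : ∀ j, A 3 j = 0 := fun j => congrFun hA' j
  have h : ∀ i j : Fin 3, A j.castSucc i.castSucc = -A i.castSucc j.castSucc :=
    fun i j => congrFun (congrFun hA i) j
  have h00 := h 0 0
  have h01 := h 0 1
  have h02 := h 0 2
  have h11 := h 1 1
  have h12 := h 1 2
  have h22 := h 2 2
  simp at h00 h01 h02 h11 h12 h22
  set D : Matrix (Fin 4) (Fin 4) ℝ := diagonal ![1, 1, 1, 0] with hD
  have hs : D * (-Aᵀ) = A * D := by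
    ext i j
    fin_cases i <;> fin_cases j <;>
      simp [hD, Matrix.diagonal_mul, Matrix.mul_diagonal, h3] <;> linarith
  have h' := exp_semiconj hs
  rw [Matrix.exp_neg, Matrix.exp_transpose] at h'
  have hu : IsUnit ((NormedSpace.exp A)ᵀ).det := by
    rw [det_transpose]
    exact exp_det_isUnit A
  have h2 : D = NormedSpace.exp A * D * (NormedSpace.exp A)ᵀ := by
    rw [← h', Matrix.mul_assoc, Matrix.nonsing_inv_mul _ hu, Matrix.mul_one]
  have horth : rotBlock (NormedSpace.exp A) * (rotBlock (NormedSpace.exp A))ᵀ = 1 := by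
    ext i j
    have h4 := congrFun (congrFun h2 i.castSucc) j.castSucc
    rw [Matrix.mul_apply, Fin.sum_univ_castSucc] at h4
    simp only [hD, Matrix.mul_diagonal, Matrix.transpose_apply] at h4
    rw [Matrix.mul_apply]
    have e : ∀ k : Fin 3, (![1, 1, 1, 0] : Fin 4 → ℝ) k.castSucc = 1 := by
      intro k; fin_cases k <;> rfl
    have e' : (![1, 1, 1, 0] : Fin 4 → ℝ) (Fin.last 3) = 0 := rfl
    simp only [e, e', mul_one, mul_zero, zero_mul, add_zero] at h4
    simp only [rotBlock, Matrix.submatrix_apply, Matrix.transpose_apply]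
    rw [← h4, Matrix.diagonal_apply, Matrix.one_apply]
    simp [e]
  refine ⟨?_, hrow⟩
  change rotBlock (NormedSpace.exp A) ∈ _
  rw [mem_specialOrthogonalGroup_iff]
  refine ⟨(mem_orthogonalGroup_iff (Fin 3) ℝ).2 horth, ?_⟩
  have hpos : 0 < (rotBlock (NormedSpace.exp A)).det := by
    rw [det_rotBlock _ hrow]
    exact exp_det_pos A
  have hsq := congrArg Matrix.det horth
  rw [det_mul, det_transpose, det_one] at hsq
  nlinarith

/-- `Exp_{SE₃} : se₃ → SE₃`, the matrix exponential. -/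
noncomputable def expSE (A : se3) : SE3 := ⟨_, exp_mem A⟩

/-! ## The product group `𝒢 = SE₃ × ℝ⁶` -/

/-- The Lie group `𝒢 = SE₃ × ℝ⁶`, with `(E₁, v₁) (E₂, v₂) = (E₁ E₂, v₁ + v₂)`. -/
abbrev StateGroup : Type := SE3 × Multiplicative (I6 → ℝ)

/-- The Lie algebra `𝔤 = se₃ × ℝ⁶` of `𝒢`, with componentwise bracket (zero on `ℝ⁶`). -/
abbrev StateAlgebra : Type := se3 × (I6 → ℝ)

/-- The first component `E` of `G = (E, v)`, as a matrix. -/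
def pose (G : StateGroup) : Matrix (Fin 4) (Fin 4) ℝ := ((G.1 : GL (Fin 4) ℝ) : Matrix _ _ ℝ)

/-- The second component `v` of `G = (E, v)`. -/
def velocity (G : StateGroup) : I6 → ℝ := G.2.toAdd

/-- `vec_𝔤 : 𝔤 → ℝ¹²`, `(η₁, η₂) ↦ (vec_se η₁, η₂)`. -/
noncomputable def vecG : StateAlgebra ≃ₗ[ℝ] (I12 → ℝ) :=
  (vecSE.prodCongr (LinearEquiv.refl ℝ (I6 → ℝ))).trans
    (LinearEquiv.sumArrowLequivProdArrow I6 I6 ℝ ℝ).symm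

/-- `mat_𝔤 = vec_𝔤⁻¹`. -/
noncomputable abbrev matG (x : I12 → ℝ) : StateAlgebra := vecG.symm x

/-- The basis of `𝔤` whose coordinates are `vec_𝔤`. -/
noncomputable def basisG : Module.Basis I12 ℝ StateAlgebra := Module.Basis.ofEquivFun vecG

/-- `Exp_𝒢 (η₁, η₂) = (Exp_{SE₃} η₁, η₂)`. -/
noncomputable def expG (η : StateAlgebra) : StateGroup := (expSE η.1, Multiplicative.ofAdd η.2)

/-- The curve `γ` in `𝒢` satisfies `γ̇(t) = γ(t) ξ` within `s`, where
`G ξ = T_{Id} L_G ξ = (E ξ₁, ξ₂)` for `G = (E, v)`. -/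
def HasLeftVelocityWithinAt (γ : ℝ → StateGroup) (ξ : StateAlgebra) (s : Set ℝ) (t : ℝ) : Prop :=
  HasDerivWithinAt (fun τ => pose (γ τ)) (pose (γ t) * (ξ.1 : Matrix (Fin 4) (Fin 4) ℝ)) s t ∧
  HasDerivWithinAt (fun τ => velocity (γ τ)) ξ.2 s t

/-! ## Ingredients of the extended Kalman filter on a Lie group -/

section General

variable {ι κ L : Type*} [Fintype ι] [DecidableEq ι] [Fintype κ] [LieRing L] [LieAlgebra ℝ L]

/-- The matrix of `ad(x)` in the basis `b`, for `x` given by its coordinates. -/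
noncomputable def adMatrix (b : Module.Basis ι ℝ L) (x : ι → ℝ) : Matrix ι ι ℝ :=
  LinearMap.toMatrix b b (LieAlgebra.ad ℝ L (b.equivFun.symm x))

/-- `C(S) = ∑ᵢⱼ Sᵢⱼ ad(bᵢ) ad(bⱼ) = 𝔼(ad(δ)²)` for noise `δ` with covariance `S`; the Itô
correction of the drift of the left-invariant error is `C(S)/12` to first order. -/
noncomputable def itoMatrix (b : Module.Basis ι ℝ L) (S : Matrix ι ι ℝ) : Matrix ι ι ℝ :=
  ∑ i, ∑ j, S i j • (adMatrix b (Pi.single i 1) * adMatrix b (Pi.single j 1))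

/-- `Φ(x) = ∑_{k ≥ 0} (-1)ᵏ / (k+1)! ad(x)ᵏ`, so that
`Log(Exp(-x) Exp(x + y)) = Φ(x) y + O(‖y‖²)`. -/
noncomputable def phiMatrix (b : Module.Basis ι ℝ L) (x : ι → ℝ) : Matrix ι ι ℝ :=
  ∑' k : ℕ, ((-1 : ℝ) ^ k / ((k + 1).factorial : ℝ)) • adMatrix b x ^ k

/-- The entrywise expectation `𝔼 (M(ε))` for a Gaussian vector `ε ∼ N(0, P)`. -/
noncomputable def gaussianMean (P : Matrix ι ι ℝ) (M : (ι → ℝ) → Matrix ι ι ℝ) : Matrix ι ι ℝ :=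
  Matrix.of fun i j => ∫ ε, M ε.ofLp i j ∂(multivariateGaussian 0 P)

end General

/-- `D` is the matrix of the differential of `φ : 𝒢 → ℝ^κ` at `G`, left-trivialised and in the
coordinates `vec_𝔤`: the derivative of `x ↦ φ(G Exp(mat_𝔤 x))` at `x = 0`. -/
def HasLeftJacobian {κ : Type*} [Fintype κ] (φ : StateGroup → κ → ℝ) (G : StateGroup)
    (D : Matrix κ I12 ℝ) : Prop :=
  HasFDerivAt (fun x : I12 → ℝ => φ (G * expG (matG x)))
    (LinearMap.toContinuousLinearMap D.mulVecLin) 0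

/-- The matrix of the left-trivialised differential of `φ` at `G`. -/
noncomputable def leftJacobian {κ : Type*} [Fintype κ] (φ : StateGroup → κ → ℝ)
    (G : StateGroup) : Matrix κ I12 ℝ :=
  LinearMap.toMatrix'
    (fderiv ℝ (fun x : I12 → ℝ => φ (G * expG (matG x))) 0).toLinearMap

/-- `J = F - ad_𝔤(f(G)) + C(S)/12` with `F = d f(G)`, for an arbitrary drift `f`. -/
noncomputable def driftJacobian (f : StateGroup → StateAlgebra) (S : Matrix I12 I12 ℝ)
    (G : StateGroup) : Matrix I12 I12 ℝ :=
  leftJacobian (fun H => vecG (f H)) G - adMatrix basisG (vecG (f G)) +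
    (1 / 12 : ℝ) • itoMatrix basisG S

/-- One step, from `t₀` to `t₁`, of the continuous-discrete extended Kalman filter on `𝒢` for
`Ġ = G (f(G) + δ)`, with white noise `δ` of covariance `S` (in the coordinates `vec_𝔤`), and the
observation `z = h(G(t₁)) + ε`, with `ε` of covariance `Q`. It starts from the estimate `G₀` with
error covariance `P₀` and returns `G₁, P₁`; `Gc, Pc` are the propagated state and covariance on
`[t₀, t₁]`, `K` the gain and `m` the correction. -/
structure IsEKFStep {κ : Type*} [Fintype κ] [DecidableEq κ]
    (f : StateGroup → StateAlgebra) (h : StateGroup → κ → ℝ)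
    (S : Matrix I12 I12 ℝ) (Q : Matrix κ κ ℝ) (t₀ t₁ : ℝ) (z : κ → ℝ)
    (G₀ : StateGroup) (P₀ : Matrix I12 I12 ℝ)
    (Gc : ℝ → StateGroup) (Pc : ℝ → Matrix I12 I12 ℝ)
    (K : Matrix I12 κ ℝ) (m : I12 → ℝ)
    (G₁ : StateGroup) (P₁ : Matrix I12 I12 ℝ) : Prop where
  state_init : Gc t₀ = G₀
  cov_init : Pc t₀ = P₀
  state_ode : ∀ t ∈ Set.Icc t₀ t₁, HasLeftVelocityWithinAt Gc (f (Gc t)) (Set.Icc t₀ t₁) t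
  cov_posSemidef : ∀ t ∈ Set.Icc t₀ t₁, (Pc t).PosSemidef
  cov_ode : ∀ t ∈ Set.Icc t₀ t₁, HasDerivWithinAt Pc
    (driftJacobian f S (Gc t) * Pc t + Pc t * (driftJacobian f S (Gc t))ᵀ + S
      + (1 / 4 : ℝ) • gaussianMean (Pc t)
          (fun ε => adMatrix basisG ε * S * (adMatrix basisG ε)ᵀ)
      + (1 / 12 : ℝ) • (gaussianMean (Pc t) (fun ε => adMatrix basisG ε ^ 2) * S)
      + (1 / 12 : ℝ) • (S * (gaussianMean (Pc t) (fun ε => adMatrix basisG ε ^ 2))ᵀ))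
    (Set.Icc t₀ t₁) t
  gain : K = Pc t₁ * (leftJacobian h (Gc t₁))ᵀ *
    (leftJacobian h (Gc t₁) * Pc t₁ * (leftJacobian h (Gc t₁))ᵀ + Q)⁻¹
  correction : m = K *ᵥ (z - h (Gc t₁))
  state_update : G₁ = Gc t₁ * expG (matG m)
  cov_update : P₁ = phiMatrix basisG m * (1 - K * leftJacobian h (Gc t₁)) * Pc t₁ *
    (phiMatrix basisG m)ᵀ

/-! ## The constant acceleration model with linear observations -/

/-- The drift `f((E, v)) = (mat_se(v), 0)` of the constant acceleration model. -/
noncomputable def constAccDrift (G : StateGroup) : StateAlgebra := (matSE (velocity G), 0)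

/-- The linear observation `h((E, v)) = E a`. -/
def linearObs (a : Fin 4 → ℝ) (G : StateGroup) : Fin 4 → ℝ := pose G *ᵥ a

/-! ## The explicit algorithm -/

/-- The explicit adjoint matrix `ad_se^vec(v)`. -/
noncomputable def adSEvec (v : I6 → ℝ) : Matrix I6 I6 ℝ :=
  fromBlocks (matSO (v ∘ .inl)) 0 (matSO (v ∘ .inr)) (matSO (v ∘ .inl))

/-- The explicit adjoint matrix `ad_𝔤^vec(v)`. -/
noncomputable def adGvec (v : I12 → ℝ) : Matrix I12 I12 ℝ :=
  fromBlocks (adSEvec (v ∘ .inl)) 0 0 0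

/-- The explicit matrix `F = (0, 1₆; 0, 0)`. -/
def explicitF : Matrix I12 I12 ℝ := fromBlocks 0 1 0 0

/-- The explicit matrix `J = F - ad_𝔤(f(G)) + C/12`, where `vec_𝔤 (f(G)) = (v, 0)` for
`G = (E, v)`. -/
noncomputable def explicitJ (C : Matrix I12 I12 ℝ) (v : I6 → ℝ) : Matrix I12 I12 ℝ :=
  explicitF - adGvec (Sum.elim v 0) + (1 / 12 : ℝ) • C

/-- The explicit `3 × 3` matrix `Ξ`, for `S` with the diagonal `s`. -/
noncomputable def explicitXi (s : I12 → ℝ) : Matrix (Fin 3) (Fin 3) ℝ :=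
  -((1 / 2 : ℝ) • diagonal ![s (.inl (.inl 1)) + s (.inl (.inl 2)),
    s (.inl (.inl 0)) + s (.inl (.inl 2)), s (.inl (.inl 0)) + s (.inl (.inl 1))])

/-- The explicit matrix `C(S)`, for the diagonal matrix `S` with the diagonal `s`. -/
noncomputable def explicitC (s : I12 → ℝ) : Matrix I12 I12 ℝ :=
  fromBlocks (fromBlocks (explicitXi s) 0 0 (explicitXi s)) 0 0 0

/-- The explicit matrix `Hᵏ ∈ ℝ^{4×12}`: its row `i` is `(vec_se(Pr(Eᵀ eᵢ aᵀ))ᵀ, 0)`. -/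
noncomputable def explicitHk (a : Fin 4 → ℝ) (E : Matrix (Fin 4) (Fin 4) ℝ) :
    Matrix (Fin 4) I12 ℝ :=
  Matrix.of fun i => Sum.elim (vecSE (prSE (Eᵀ * vecMulVec (Pi.single i 1) a))) 0

/-- The explicit observation matrix `H = ∑ₖ Hᵏ`. -/
noncomputable def explicitH {n : ℕ} (a : Fin n → Fin 4 → ℝ) (E : Matrix (Fin 4) (Fin 4) ℝ) :
    Matrix (Fin 4) I12 ℝ :=
  ∑ k, explicitHk (a k) E

/-- `Φ_{SE₃}(v) = ∑_{k ≥ 0} (-1)ᵏ / (k+1)! ad_se^vec(v)ᵏ`. -/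
noncomputable def phiSE (v : I6 → ℝ) : Matrix I6 I6 ℝ :=
  ∑' k : ℕ, ((-1 : ℝ) ^ k / ((k + 1).factorial : ℝ)) • adSEvec v ^ k

/-- The block matrix `Φ(v) = (Φ_{SE₃}(v_{1:6}), 0; 0, 1₆)`. -/
noncomputable def explicitPhi (v : I12 → ℝ) : Matrix I12 I12 ℝ :=
  fromBlocks (phiSE (v ∘ .inl)) 0 0 1

/-- One pass of the explicit algorithm, from `t₀` to `t₁`, with the observations
`y₁, …, yₙ ∈ ℝ⁴` at `t₁`. The matrix `C` is the one that enters `J`. -/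
structure IsAlgorithmStep {n : ℕ} (a : Fin n → Fin 4 → ℝ) (C : Matrix I12 I12 ℝ)
    (S : Matrix I12 I12 ℝ) (Q : Matrix (Fin 4) (Fin 4) ℝ) (t₀ t₁ : ℝ) (y : Fin n → Fin 4 → ℝ)
    (G₀ : StateGroup) (P₀ : Matrix I12 I12 ℝ)
    (Gc : ℝ → StateGroup) (Pc : ℝ → Matrix I12 I12 ℝ)
    (K : Matrix I12 (Fin 4) ℝ) (m : I12 → ℝ)
    (G₁ : StateGroup) (P₁ : Matrix I12 I12 ℝ) : Prop where
  state_init : Gc t₀ = G₀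
  cov_init : Pc t₀ = P₀
  pose_ode : ∀ t ∈ Set.Icc t₀ t₁, HasDerivWithinAt (fun τ => pose (Gc τ))
    (pose (Gc t) * (matSE (velocity (Gc t)) : Matrix (Fin 4) (Fin 4) ℝ)) (Set.Icc t₀ t₁) t
  velocity_ode : ∀ t ∈ Set.Icc t₀ t₁,
    HasDerivWithinAt (fun τ => velocity (Gc τ)) 0 (Set.Icc t₀ t₁) t
  cov_posSemidef : ∀ t ∈ Set.Icc t₀ t₁, (Pc t).PosSemidef
  cov_ode : ∀ t ∈ Set.Icc t₀ t₁, HasDerivWithinAt Pc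
    (explicitJ C (velocity (Gc t)) * Pc t + Pc t * (explicitJ C (velocity (Gc t)))ᵀ + S
      + (1 / 4 : ℝ) • gaussianMean (Pc t) (fun ε => adGvec ε * S * (adGvec ε)ᵀ)
      + (1 / 12 : ℝ) • (gaussianMean (Pc t) (fun ε => adGvec ε ^ 2) * S)
      + (1 / 12 : ℝ) • (S * (gaussianMean (Pc t) (fun ε => adGvec ε ^ 2))ᵀ))
    (Set.Icc t₀ t₁) t
  gain : K = Pc t₁ * (explicitH a (pose (Gc t₁)))ᵀ *
    (explicitH a (pose (Gc t₁)) * Pc t₁ * (explicitH a (pose (Gc t₁)))ᵀ + Q)⁻¹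
  correction : m = K *ᵥ ∑ k, (y k - pose (Gc t₁) *ᵥ a k)
  pose_update : pose G₁ = pose (Gc t₁) *
    NormedSpace.exp (matSE (m ∘ .inl) : Matrix (Fin 4) (Fin 4) ℝ)
  velocity_update : velocity G₁ = velocity (Gc t₁) + m ∘ .inr
  cov_update : P₁ = explicitPhi m * (1 - K * explicitH a (pose (Gc t₁))) * Pc t₁ *
    (explicitPhi m)ᵀ

end LieEKF

open LieEKF

namespace LieEKF

open Matrix

/-! ## Coordinates -/

/-! The filter step and the algorithm are the same system of equations once the coefficient matrices
are identified, so no differential equation is solved and no expectation is computed.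

The observation `E exp(mat x) a` has derivative `E mat(x) a` at `x = 0`. `Pr` is the orthogonal
projection onto `se₃` for the Frobenius inner product, and the factor `1/√2` makes `mat_se` an
isometry. Hence entry `i` of `E mat(x) a`, the Frobenius product of `Eᵀ eᵢ aᵀ` with `mat x`, is the
scalar product of `vec(Pr(Eᵀ eᵢ aᵀ))` with `x` (`explicitHk_mulVec`, `hasLeftJacobian_linearObs`).
The drift is affine in the velocity, which gives `F`.

The factor `ℝ⁶` is abelian, so `ad` lives in the `se₃` block, where it is the commutator written in
coordinates (`adMatrix_basisG`). This identifies the Gaussian integrands pointwise and reduces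
`C(S)` and `Φ` to block computations (`itoMatrix_diagonal`, `phiMatrix_basisG`). -/

lemma matG_apply (x : I12 → ℝ) : matG x = (matSE (x ∘ .inl), x ∘ .inr) := rfl

lemma vecG_apply (η : StateAlgebra) : vecG η = Sum.elim (vecSE η.1) η.2 := rfl

lemma vecSE_apply (A : se3) : vecSE A = Sum.elim
    ![√2 * (A : Matrix (Fin 4) (Fin 4) ℝ) 2 1, √2 * (A : Matrix (Fin 4) (Fin 4) ℝ) 0 2,
      √2 * (A : Matrix (Fin 4) (Fin 4) ℝ) 1 0]
    ![(A : Matrix (Fin 4) (Fin 4) ℝ) 0 3, (A : Matrix (Fin 4) (Fin 4) ℝ) 1 3,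
      (A : Matrix (Fin 4) (Fin 4) ℝ) 2 3] := rfl

lemma coe_matSE (x : I6 → ℝ) : (matSE x : Matrix (Fin 4) (Fin 4) ℝ) =
    !![0, -(x (.inl 2) / √2), x (.inl 1) / √2, x (.inr 0);
      x (.inl 2) / √2, 0, -(x (.inl 0) / √2), x (.inr 1);
      -(x (.inl 1) / √2), x (.inl 0) / √2, 0, x (.inr 2);
      0, 0, 0, 0] := rfl

lemma velocity_mul_expG (G : StateGroup) (η : StateAlgebra) :
    velocity (G * expG η) = velocity G + η.2 := rfl

lemma stateGroup_ext {G H : StateGroup} (hp : pose G = pose H)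
    (hv : velocity G = velocity H) : G = H :=
  Prod.ext (Subtype.ext (Units.ext hp)) hv

lemma stateGroup_eq_iff {G H : StateGroup} :
    G = H ↔ pose G = pose H ∧ velocity G = velocity H :=
  ⟨fun h => h ▸ ⟨rfl, rfl⟩, fun h => stateGroup_ext h.1 h.2⟩

/-! ## Left Jacobians -/

/-- `leftJacobian` is built from `fderiv`, which is zero by default where there is no derivative; an
actual derivative is needed to fix its value. -/
lemma HasLeftJacobian.leftJacobian_eq {κ : Type*} [Fintype κ] {φ : StateGroup → κ → ℝ}
    {G : StateGroup} {D : Matrix κ I12 ℝ} (h : HasLeftJacobian φ G D) :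
    leftJacobian φ G = D := by
  rw [leftJacobian, HasFDerivAt.fderiv h]
  exact LinearMap.toMatrix'_toLin' D

lemma HasLeftJacobian.sum {ι κ : Type*} [Fintype κ] {s : Finset ι}
    {φ : ι → StateGroup → κ → ℝ} {G : StateGroup} {D : ι → Matrix κ I12 ℝ}
    (h : ∀ i ∈ s, HasLeftJacobian (φ i) G (D i)) :
    HasLeftJacobian (fun G' => ∑ i ∈ s, φ i G') G (∑ i ∈ s, D i) := by
  have hD : LinearMap.toContinuousLinearMap (∑ i ∈ s, D i).mulVecLin =
      ∑ i ∈ s, LinearMap.toContinuousLinearMap (D i).mulVecLin := by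
    ext1 x
    simp
  rw [HasLeftJacobian, hD]
  exact HasFDerivAt.fun_sum h

/-- `Pr` can be dropped when pairing with an element of `se₃`, since it is the Frobenius-orthogonal
projection; what remains is `⟨Eᵀ eᵢ aᵀ, mat x⟩ = eᵢᵀ E mat(x) a`. -/
lemma explicitHk_mulVec (a : Fin 4 → ℝ) (E : Matrix (Fin 4) (Fin 4) ℝ) (x : I12 → ℝ) :
    explicitHk a E *ᵥ x =
      (E * (matSE (x ∘ .inl) : Matrix (Fin 4) (Fin 4) ℝ)) *ᵥ a := by
  have h2 : √2 ≠ 0 := by positivity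
  have hs : √2 ^ 2 = 2 := Real.sq_sqrt (by norm_num)
  ext i
  rw [coe_matSE]
  have hA : ∀ j k, (Eᵀ * vecMulVec (Pi.single i 1) a) j k = E i j * a k := fun j k => by
    simp [Matrix.mul_vecMulVec, Matrix.vecMulVec_apply]
  have hk : ∀ j, explicitHk a E i j =
      Sum.elim (vecSE (prSE (Eᵀ * vecMulVec (Pi.single i 1) a))) (0 : I6 → ℝ) j := fun j => rfl
  -- The rank-one matrix is kept opaque, known only through its entries `E i j * a k`.
  generalize Eᵀ * vecMulVec (Pi.single i 1) a = A at hA hk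
  simp only [Matrix.mulVec, dotProduct, hk, vecSE_apply, Fintype.sum_sum_type]
  simp [Matrix.mul_apply, prSE, hA, Fin.sum_univ_four, Fin.sum_univ_three]
  field_simp
  -- Only the rotational terms still differ: `√2 ^ 2` on one side, `2` on the other. Their
  -- coefficients are the skew parts of `A`.
  linear_combination ((E i 2 * a 1 - E i 1 * a 2) * x (.inl (.inl 0)) +
    (E i 0 * a 2 - E i 2 * a 0) * x (.inl (.inl 1)) +
    (E i 1 * a 0 - E i 0 * a 1) * x (.inl (.inl 2))) * hs

section
attribute [local instance] Matrix.linftyOpNormedRing Matrix.linftyOpNormedAlgebra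

lemma hasLeftJacobian_linearObs (a : Fin 4 → ℝ) (G : StateGroup) :
    HasLeftJacobian (linearObs a) G (explicitHk a (pose G)) := by
  let T : (I12 → ℝ) →L[ℝ] Matrix (Fin 4) (Fin 4) ℝ :=
    LinearMap.toContinuousLinearMap (se3.toSubmodule.subtype ∘ₗ vecSE.symm.toLinearMap ∘ₗ
        LinearMap.funLeft ℝ ℝ (.inl : I6 → I12))
  let L : Matrix (Fin 4) (Fin 4) ℝ →L[ℝ] (Fin 4 → ℝ) :=
    LinearMap.toContinuousLinearMap
      ((Matrix.mulVecBilin ℝ ℝ).flip a ∘ₗ LinearMap.mulLeft ℝ (pose G))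
  have h1 : HasFDerivAt (NormedSpace.exp : Matrix (Fin 4) (Fin 4) ℝ → _)
      (1 : Matrix (Fin 4) (Fin 4) ℝ →L[ℝ] Matrix (Fin 4) (Fin 4) ℝ) (T 0) := by
    rw [map_zero]
    exact hasFDerivAt_exp_zero
  have hD : LinearMap.toContinuousLinearMap (explicitHk a (pose G)).mulVecLin = L ∘L T := by
    ext1 x
    exact explicitHk_mulVec a (pose G) x
  rw [HasLeftJacobian, hD]
  -- The function to differentiate is by definition `L ∘ exp ∘ T`, with `T` and `L` linear, and
  -- `exp` has derivative `1` at `T 0 = 0`.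
  exact L.hasFDerivAt.comp (0 : I12 → ℝ) (h1.comp (0 : I12 → ℝ) T.hasFDerivAt)

end

lemma hasLeftJacobian_sum_linearObs {n : ℕ} (a : Fin n → Fin 4 → ℝ) (G : StateGroup) :
    HasLeftJacobian (fun G' => ∑ k, linearObs (a k) G') G (explicitH a (pose G)) :=
  HasLeftJacobian.sum fun k _ => hasLeftJacobian_linearObs (a k) G

/-- Right multiplication by `Exp` adds `x₇,…,x₁₂` to the velocity, so the drift is exactly affine in
`x`. -/
lemma hasLeftJacobian_constAccDrift (G : StateGroup) :
    HasLeftJacobian (fun G' => vecG (constAccDrift G')) G explicitF := by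
  have h : ∀ x : I12 → ℝ, vecG (constAccDrift (G * expG (matG x))) =
      LinearMap.toContinuousLinearMap explicitF.mulVecLin x + Sum.elim (velocity G) 0 := by
    intro x
    rw [vecG_apply, constAccDrift, velocity_mul_expG, matG_apply]
    ext (i | i) <;> simp [explicitF, Matrix.fromBlocks_mulVec, add_comm]
  unfold HasLeftJacobian
  simp only [h]
  exact (ContinuousLinearMap.hasFDerivAt _).add_const _

/-! ## The adjoint representation -/

/-- For `(Ω, w)` and `(Ω', w')` the commutator is `([Ω, Ω'], Ω w' - Ω' w)`. Both `[Ω, Ω']` and `-Ω'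
w` become cross products, antisymmetric in their factors, which gives the lower triangular form. -/
lemma vecSE_lie_matSE (x y : I6 → ℝ) : vecSE ⁅matSE x, matSE y⁆ = adSEvec x *ᵥ y := by
  have h2 : √2 ≠ 0 := by positivity
  have hs : √2 ^ 2 = 2 := Real.sq_sqrt (by norm_num)
  have hl : ((⁅matSE x, matSE y⁆ : se3) : Matrix (Fin 4) (Fin 4) ℝ) =
      (matSE x : Matrix (Fin 4) (Fin 4) ℝ) * (matSE y : Matrix (Fin 4) (Fin 4) ℝ) -
        (matSE y : Matrix (Fin 4) (Fin 4) ℝ) * (matSE x : Matrix (Fin 4) (Fin 4) ℝ) := rfl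
  rw [vecSE_apply, hl, coe_matSE, coe_matSE]
  ext (i | i) <;> fin_cases i <;>
    simp [adSEvec, matSO, Matrix.mulVec, dotProduct, Fin.sum_univ_three] <;>
    field_simp <;> ring

lemma lie_matG (x y : I12 → ℝ) :
    ⁅matG x, matG y⁆ = ((⁅matSE (x ∘ .inl), matSE (y ∘ .inl)⁆, 0) : StateAlgebra) := by
  refine Prod.ext rfl ?_
  ext k
  -- The bracket on `ℝ⁶` is, entry by entry, a commutator of real numbers.
  exact sub_eq_zero.2 (mul_comm _ _)

lemma adMatrix_basisG (x : I12 → ℝ) : adMatrix basisG x = adGvec x := by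
  have hb : ∀ y, basisG.equivFun.symm y = matG y := fun y => by simp [basisG, matG]
  refine Matrix.mulVec_injective (funext fun y => ?_)
  have h := LinearMap.toMatrix_mulVec_repr basisG basisG
    (LieAlgebra.ad ℝ StateAlgebra (matG x)) (matG y)
  have hr : ∀ η, (basisG.repr η : I12 → ℝ) = vecG η := fun η => rfl
  rw [hr, hr, LinearEquiv.apply_symm_apply, LieAlgebra.ad_apply, lie_matG, vecG_apply] at h
  rw [adMatrix, hb, h, vecSE_lie_matSE]
  simp [adGvec, Matrix.fromBlocks_mulVec]

/-! ### The matrix `C(S)` and the drift Jacobian -/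

lemma matSO_zero : matSO 0 = 0 := by
  ext i j
  fin_cases i <;> fin_cases j <;> simp [matSO]

lemma adSEvec_zero : adSEvec 0 = 0 := by
  have h : ((0 : I6 → ℝ) ∘ Sum.inl : Fin 3 → ℝ) = 0 := rfl
  have h' : ((0 : I6 → ℝ) ∘ Sum.inr : Fin 3 → ℝ) = 0 := rfl
  rw [adSEvec, h, h', matSO_zero, fromBlocks_zero]

/-- Each square is `matSO(eᵢ)² = -(1 - eᵢ eᵢᵀ)/2`, so `sᵢ` contributes to the two diagonal entries
other than the `i`-th. -/
lemma sum_smul_matSO_single_sq (s : I12 → ℝ) :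
    ∑ i, s (.inl (.inl i)) • (matSO (Pi.single i 1) * matSO (Pi.single i 1)) = explicitXi s := by
  have h2 : √2 ≠ 0 := by positivity
  have hs : √2 ^ 2 = 2 := Real.sq_sqrt (by norm_num)
  ext i j
  fin_cases i <;> fin_cases j <;>
    simp [explicitXi, matSO, Fin.sum_univ_three] <;>
    field_simp <;> rw [hs] <;> ring

lemma adGvec_single_sq_inl_inl (i : Fin 3) :
    adGvec (Pi.single (.inl (.inl i)) 1) * adGvec (Pi.single (.inl (.inl i)) 1) =
      fromBlocks (fromBlocks (matSO (Pi.single i 1) * matSO (Pi.single i 1)) 0 0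
        (matSO (Pi.single i 1) * matSO (Pi.single i 1))) 0 0 0 := by
  have h1 : (Pi.single (.inl (.inl i)) 1 : I12 → ℝ) ∘ Sum.inl = Pi.single (.inl i) 1 := by
    ext j; simp [Pi.single_apply]
  have h2 : (Pi.single (.inl i) 1 : I6 → ℝ) ∘ Sum.inl = Pi.single i 1 := by
    ext j; simp [Pi.single_apply]
  have h3 : (Pi.single (.inl i) 1 : I6 → ℝ) ∘ Sum.inr = 0 := by
    ext j; simp
  simp [adGvec, adSEvec, h1, h2, h3, matSO_zero, fromBlocks_multiply]

/-- `ad` of a translation has only the block below the diagonal, so it squares to zero. -/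
lemma adGvec_single_sq_inl_inr (i : Fin 3) :
    adGvec (Pi.single (.inl (.inr i)) 1) * adGvec (Pi.single (.inl (.inr i)) 1) = 0 := by
  have h1 : (Pi.single (.inl (.inr i)) 1 : I12 → ℝ) ∘ Sum.inl = Pi.single (.inr i) 1 := by
    ext j; simp [Pi.single_apply]
  have h2 : (Pi.single (.inr i) 1 : I6 → ℝ) ∘ Sum.inl = 0 := by
    ext j; simp
  simp [adGvec, adSEvec, h1, h2, matSO_zero, fromBlocks_multiply]

lemma adGvec_single_inr (i : I6) : adGvec (Pi.single (.inr i) 1) = 0 := by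
  have h1 : (Pi.single (.inr i) 1 : I12 → ℝ) ∘ Sum.inl = 0 := by
    ext j; simp
  simp [adGvec, h1, adSEvec_zero]

/-- Diagonal noise leaves the squares `ad(eᵢ)²`. Translations are nilpotent and velocity directions
central, so only the three rotations contribute. -/
lemma itoMatrix_diagonal (s : I12 → ℝ) :
    itoMatrix basisG (Matrix.diagonal s) = explicitC s := by
  have h : itoMatrix basisG (Matrix.diagonal s) =
      ∑ i, s i • (adGvec (Pi.single i 1) * adGvec (Pi.single i 1)) := by
    refine Finset.sum_congr rfl fun i _ => ?_
    rw [Finset.sum_eq_single i]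
    · simp only [diagonal_apply_eq, adMatrix_basisG]
    · intro j _ hj
      rw [diagonal_apply_ne' _ hj, zero_smul]
    · simp
  rw [h, Fintype.sum_sum_type, Fintype.sum_sum_type]
  simp only [adGvec_single_sq_inl_inl, adGvec_single_sq_inl_inr, adGvec_single_inr, mul_zero,
    smul_zero, Finset.sum_const_zero, add_zero]
  rw [explicitC, ← sum_smul_matSO_single_sq]
  ext ((i | i) | i) ((j | j) | j) <;> simp [Matrix.sum_apply]

lemma driftJacobian_constAccDrift (S : Matrix I12 I12 ℝ) (G : StateGroup) :
    driftJacobian constAccDrift S G = explicitJ (itoMatrix basisG S) (velocity G) := by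
  rw [driftJacobian, (hasLeftJacobian_constAccDrift G).leftJacobian_eq, adMatrix_basisG]
  simp [explicitJ, vecG_apply, constAccDrift]

/-! ### The series `Φ` -/

lemma adGvec_pow_succ (x : I12 → ℝ) (k : ℕ) :
    adGvec x ^ (k + 1) = fromBlocks (adSEvec (x ∘ .inl) ^ (k + 1)) 0 0 0 := by
  induction k with
  | zero => simp [adGvec]
  | succ k ih => rw [pow_succ, ih, pow_succ _ (k + 1), adGvec, fromBlocks_multiply]; simp

section
attribute [local instance] Matrix.linftyOpNormedRing Matrix.linftyOpNormedAlgebra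

lemma summable_phi {ι : Type*} [Fintype ι] [DecidableEq ι] (A : Matrix ι ι ℝ) :
    Summable fun k : ℕ => ((-1 : ℝ) ^ k / ((k + 1).factorial : ℝ)) • A ^ k := by
  refine Summable.of_norm_bounded_eventually (g := fun k => ((k.factorial : ℝ)⁻¹ * ‖A‖ ^ k)) ?_ ?_
  · simpa [div_eq_inv_mul] using Real.summable_pow_div_factorial ‖A‖
  · rw [Nat.cofinite_eq_atTop]
    filter_upwards [Filter.eventually_gt_atTop 0] with k hk
    -- Restricting to `k > 0` avoids `‖1‖ = 1`, which fails for empty `ι`.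
    rw [norm_smul, norm_div, norm_pow, norm_neg, norm_one, one_pow, one_div]
    gcongr
    · simp only [Real.norm_natCast]
      exact_mod_cast Nat.factorial_le (Nat.le_succ k)
    · exact norm_pow_le' A hk

end

lemma hasSum_fromBlocks_diagonal {m n β : Type*} {f : β → Matrix m m ℝ} {g : β → Matrix n n ℝ}
    {A : Matrix m m ℝ} {D : Matrix n n ℝ} (hf : HasSum f A) (hg : HasSum g D) :
    HasSum (fun k => fromBlocks (f k) 0 0 (g k)) (fromBlocks A 0 0 D) := by
  let φ : Matrix m m ℝ × Matrix n n ℝ →+ Matrix (m ⊕ n) (m ⊕ n) ℝ :=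
    { toFun := fun p => fromBlocks p.1 0 0 p.2
      map_zero' := fromBlocks_zero
      map_add' := fun p q => by simp [fromBlocks_add] }
  exact (hf.prodMk hg).map φ
    (continuous_fst.matrix_fromBlocks continuous_const continuous_const continuous_snd)

/-- All powers of `ad` of exponent at least one vanish outside the `se₃` block. The block `1₆` of
`Φ` therefore comes solely from the term `k = 0`, whose coefficient is `1`. -/
lemma phiMatrix_basisG (x : I12 → ℝ) : phiMatrix basisG x = explicitPhi x := by
  rw [phiMatrix, explicitPhi, phiSE]
  simp only [adMatrix_basisG]
  refine HasSum.tsum_eq ?_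
  have h1 := (summable_phi (adSEvec (x ∘ .inl))).hasSum
  -- The velocity block as a series with the single term `k = 0`.
  have h2 : HasSum (fun k : ℕ => if k = 0 then (1 : Matrix I6 I6 ℝ) else 0) 1 :=
    hasSum_ite_eq 0 1
  have h3 := hasSum_fromBlocks_diagonal h1 h2
  convert h3 using 2 with k
  cases k with
  | zero => simp [← fromBlocks_one]
  | succ k => rw [adGvec_pow_succ]; simp [fromBlocks_smul]

/-! ## The filter step -/

/-- After substituting the coefficient matrices, the fields match one by one. The equations for the
state and its update split into pose and velocity, and the innovation `z - h` becomes a sum over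
`k`. -/
theorem isEKFStep_iff_isAlgorithmStep {n : ℕ} (a : Fin n → Fin 4 → ℝ)
    (S : Matrix I12 I12 ℝ) (Q : Matrix (Fin 4) (Fin 4) ℝ) (t₀ t₁ : ℝ)
    (y : Fin n → Fin 4 → ℝ) (G₀ : StateGroup) (P₀ : Matrix I12 I12 ℝ)
    (Gc : ℝ → StateGroup) (Pc : ℝ → Matrix I12 I12 ℝ)
    (K : Matrix I12 (Fin 4) ℝ) (m : I12 → ℝ) (G₁ : StateGroup) (P₁ : Matrix I12 I12 ℝ) :
    IsEKFStep constAccDrift (fun G' => ∑ k, linearObs (a k) G') S Q t₀ t₁ (∑ k, y k)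
        G₀ P₀ Gc Pc K m G₁ P₁ ↔
      IsAlgorithmStep a (itoMatrix basisG S) S Q t₀ t₁ y G₀ P₀ Gc Pc K m G₁ P₁ := by
  have hH := fun G => (hasLeftJacobian_sum_linearObs a G).leftJacobian_eq
  have hz : ∑ k, y k - ∑ k, linearObs (a k) (Gc t₁) =
      ∑ k, (y k - pose (Gc t₁) *ᵥ a k) := (Finset.sum_sub_distrib _ _).symm
  constructor
  · rintro ⟨h1, h2, h3, h4, h5, h6, h7, h8, h9⟩
    simp only [hH, hz, driftJacobian_constAccDrift, adMatrix_basisG, phiMatrix_basisG]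
      at h5 h6 h7 h9
    rw [stateGroup_eq_iff] at h8
    exact ⟨h1, h2, fun t ht => (h3 t ht).1, fun t ht => (h3 t ht).2, h4, h5, h6, h7, h8.1, h8.2, h9⟩
  · rintro ⟨h1, h2, h3, h3', h4, h5, h6, h7, h8, h8', h9⟩
    refine ⟨h1, h2, fun t ht => ⟨h3 t ht, h3' t ht⟩, h4, ?_, ?_, ?_, stateGroup_ext h8 h8', ?_⟩
    all_goals
      simp only [hH, hz, driftJacobian_constAccDrift, adMatrix_basisG, phiMatrix_basisG]
      assumption

end LieEKF

open LieEKF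
theorem mainTheorem5 (n : ℕ) (a : Fin n → Fin 4 → ℝ) :
    -- the differential of the `k`-th observation function is the explicit `4 × 12` matrix
    (∀ (G : StateGroup) (k : Fin n),
      HasLeftJacobian (linearObs (a k)) G (explicitHk (a k) (pose G))) ∧
    -- the differential of the summed observation function is `H = ∑ₖ Hᵏ`
    (∀ G : StateGroup,
      HasLeftJacobian (fun G' => ∑ k, linearObs (a k) G') G (explicitH a (pose G)) ∧
      leftJacobian (fun G' => ∑ k, linearObs (a k) G') G = explicitH a (pose G)) ∧
    -- the differential of the drift is `F`, and the adjoint matrix has the stated block form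
    (∀ G : StateGroup,
      HasLeftJacobian (fun G' => vecG (constAccDrift G')) G explicitF) ∧
    (∀ x : I12 → ℝ, adMatrix basisG x = adGvec x) ∧
    -- `J` is as stated, with the explicit `C(S)` if `S` is diagonal
    (∀ (S : Matrix I12 I12 ℝ) (G : StateGroup),
      driftJacobian constAccDrift S G = explicitJ (itoMatrix basisG S) (velocity G)) ∧
    (∀ s : I12 → ℝ, itoMatrix basisG (Matrix.diagonal s) = explicitC s) ∧
    -- `Φ` has the stated block form
    (∀ x : I12 → ℝ, phiMatrix basisG x = explicitPhi x) ∧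
    -- the extended Kalman filter is the explicit algorithm
    (∀ (S : Matrix I12 I12 ℝ) (Q : Matrix (Fin 4) (Fin 4) ℝ) (t₀ t₁ : ℝ)
      (y : Fin n → Fin 4 → ℝ) (G₀ : StateGroup) (P₀ : Matrix I12 I12 ℝ)
      (Gc : ℝ → StateGroup) (Pc : ℝ → Matrix I12 I12 ℝ)
      (K : Matrix I12 (Fin 4) ℝ) (m : I12 → ℝ) (G₁ : StateGroup) (P₁ : Matrix I12 I12 ℝ),
      S.PosSemidef → Q.PosDef → t₀ < t₁ →
      (IsEKFStep constAccDrift (fun G' => ∑ k, linearObs (a k) G') S Q t₀ t₁ (∑ k, y k)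
          G₀ P₀ Gc Pc K m G₁ P₁ ↔
        IsAlgorithmStep a (itoMatrix basisG S) S Q t₀ t₁ y G₀ P₀ Gc Pc K m G₁ P₁)) ∧
    (∀ (s : I12 → ℝ) (Q : Matrix (Fin 4) (Fin 4) ℝ) (t₀ t₁ : ℝ)
      (y : Fin n → Fin 4 → ℝ) (G₀ : StateGroup) (P₀ : Matrix I12 I12 ℝ)
      (Gc : ℝ → StateGroup) (Pc : ℝ → Matrix I12 I12 ℝ)
      (K : Matrix I12 (Fin 4) ℝ) (m : I12 → ℝ) (G₁ : StateGroup) (P₁ : Matrix I12 I12 ℝ),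
      (∀ i, 0 ≤ s i) → Q.PosDef → t₀ < t₁ →
      (IsEKFStep constAccDrift (fun G' => ∑ k, linearObs (a k) G') (Matrix.diagonal s) Q t₀ t₁
          (∑ k, y k) G₀ P₀ Gc Pc K m G₁ P₁ ↔
        IsAlgorithmStep a (explicitC s) (Matrix.diagonal s) Q t₀ t₁ y
          G₀ P₀ Gc Pc K m G₁ P₁)) := by
  refine ⟨fun G k => hasLeftJacobian_linearObs (a k) G,
    fun G => ⟨hasLeftJacobian_sum_linearObs a G,
      (hasLeftJacobian_sum_linearObs a G).leftJacobian_eq⟩,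
    hasLeftJacobian_constAccDrift, adMatrix_basisG, driftJacobian_constAccDrift,
    itoMatrix_diagonal, phiMatrix_basisG, ?_, ?_⟩
  · intro S Q t₀ t₁ y G₀ P₀ Gc Pc K m G₁ P₁ _ _ _
    exact isEKFStep_iff_isAlgorithmStep a S Q t₀ t₁ y G₀ P₀ Gc Pc K m G₁ P₁
  · intro s Q t₀ t₁ y G₀ P₀ Gc Pc K m G₁ P₁ _ _ _
    -- Turning the explicit matrix back into `C(S)` reduces the diagonal case to the general one.
    rw [← itoMatrix_diagonal s]
    exact isEKFStep_iff_isAlgorithmStep a _ Q t₀ t₁ y G₀ P₀ Gc Pc K m G₁ P₁
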